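/- Let $\mathsf X$ and $\hat{\mathsf X}$ be finite alphabets, let $\bar P_X$ be a probability distribution on $\mathsf X$ (the law of a discrete memoryless source), and let $\bar P_{X|\hat X}$ be a channel from $\hat{\mathsf X}$ to $\mathsf X$ (the posterior, or backward, channel). An $(n,\Theta)$ protocol consists of a randomized encoder $\mathcal E^{(n)}:\mathsf X^n\to[\Theta]=\{1,\dots,\Theta\}$ and a randomized decoder $\mathcal D^{(n)}:[\Theta]\to\hat{\mathsf X}^n$. It induces the joint distribution $$P_{X^n\hat X^n}(x^n,\hat x^n)=\prod_{i=1}^n\bar P_X(x_i)\sum_{m\in[\Theta]}\mathcal E^{(n)}(m|x^n)\,\mathcal D^{(n)}(\hat x^n|m),$$ with marginal $P_{\hat X^n}$ on $\hat{\mathsf X}^n$, and its error is the total variation distance $$\Xi(\mathcal E^{(n)},\mathcal D^{(n)})=\frac12\sum_{x^n,\hat x^n}\Bigl|P_{X^n\hat X^n}(x^n,\hat x^n)-P_{\hat X^n}(\hat x^n)\prod_{i=1}^n\bar P_{X|\hat X}(x_i|\hat x_i)\Bigr|.$$ A rate $R\in\mathbb R$ is achievable if for every $\epsilon>0$ and all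 sufficiently large $n$ there is an $(n,\Theta)$ protocol, for some $\Theta$, such that $\frac1n\log_2\Theta\le R+\epsilon$ and $\Xi(\mathcal E^{(n)},\mathcal D^{(n)})\le\epsilon$. Let $$\mathcal A=\Bigl\{P_{\hat X}\ \text{a probability distribution on}\ \hat{\mathsf X}:\ \sum_{\hat x}P_{\hat X}(\hat x)\,\bar P_{X|\hat X}(x|\hat x)=\bar P_X(x)\ \text{for all}\ x\in\mathsf X\Bigr\}.$$ **Theorem.** If $\mathcal A$ is non-empty, then the mutual information $I(X;\hat X)$ (in bits) of the joint distribution $P_{\hat X}(\hat x)\bar P_{X|\hat X}(x|\hat x)$ attains a minimum over $P_{\hat X}\in\mathcal A$. A rate $R$ is achievable if and only if $\mathcal A$ is non-empty and $$R\ \ge\ \min_{P_{\hat X}\in\mathcal A} I(X;\hat X).$$ -/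

import Mathlib

open Filter

noncomputable section

namespace LossySourceCoding

/-- A discrete channel from `A` to `B`: a probability distribution on `B` for each `a : A`.
Probability distributions on a finite alphabet are points of the standard simplex. -/
abbrev Channel (A B : Type*) [Fintype B] := A → stdSimplex ℝ B

/-- The `n`-fold product distribution, `P^n(x^n) = ∏ i, P (x_i)`. -/
def iidDist {X : Type*} [Fintype X] (P : stdSimplex ℝ X) (n : ℕ) (x : Fin n → X) : ℝ :=
  ∏ i, P (x i)

/-- The `n`-fold product channel, `W^n(x^n | y^n) = ∏ i, W (x_i | y_i)`. -/
def iidChannel {X Y : Type*} [Fintype X] (W : Channel Y X) (n : ℕ)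
    (y : Fin n → Y) (x : Fin n → X) : ℝ :=
  ∏ i, W (y i) (x i)

/-- An `(n, Θ)` lossy source compression protocol: a randomized encoding map
`X^n → [Θ]` and a randomized decoding map `[Θ] → Y^n`. -/
structure Protocol (X Y : Type*) [Fintype X] [Fintype Y] (n Θ : ℕ) where
  encoder : Channel (Fin n → X) (Fin Θ)
  decoder : Channel (Fin Θ) (Fin n → Y)

variable {X Y : Type*} [Fintype X] [Fintype Y]

/-- The system-induced joint distribution of the source vector and its reconstruction. -/
def Protocol.inducedDist {n Θ : ℕ} (C : Protocol X Y n Θ) (P : stdSimplex ℝ X)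
    (x : Fin n → X) (y : Fin n → Y) : ℝ :=
  iidDist P n x * ∑ m, C.encoder x m * C.decoder m y

/-- The distribution of the reconstruction vector: the marginal of the induced distribution. -/
def Protocol.reconstructionDist {n Θ : ℕ} (C : Protocol X Y n Θ) (P : stdSimplex ℝ X)
    (y : Fin n → Y) : ℝ :=
  ∑ x, C.inducedDist P x y

/-- The error of a protocol: the total variation distance between the induced distribution and
the approximating distribution, which is the reconstruction distribution followed by the
`n`-fold product of the posterior channel. -/
def Protocol.error {n Θ : ℕ} (C : Protocol X Y n Θ) (P : stdSimplex ℝ X) (W : Channel Y X) : ℝ :=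
  (1 / 2) * ∑ x, ∑ y, |C.inducedDist P x y - C.reconstructionDist P y * iidChannel W n y x|

/-- Achievability of the rate `R` (in bits per source symbol). -/
def IsAchievable (P : stdSimplex ℝ X) (W : Channel Y X) (R : ℝ) : Prop :=
  ∀ ε : ℝ, 0 < ε → ∀ᶠ n : ℕ in atTop, ∃ (Θ : ℕ) (C : Protocol X Y n Θ),
    (1 / (n : ℝ)) * Real.logb 2 (Θ : ℝ) ≤ R + ε ∧ C.error P W ≤ ε

/-- The reconstruction distributions `Q` whose image under the posterior channel `W` is `P`. -/
def feasibleSet (P : stdSimplex ℝ X) (W : Channel Y X) : Set (stdSimplex ℝ Y) :=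
  {Q | ∀ x, ∑ y, Q y * W y x = P x}

/-- The mutual information (in bits) of a joint distribution `J` on `X × Y`. Terms with
`J x y = 0` vanish. -/
def mutualInfo (J : X → Y → ℝ) : ℝ :=
  ∑ x, ∑ y, J x y * Real.logb 2 (J x y / ((∑ y', J x y') * (∑ x', J x' y)))

/-- The mutual information `I(X; Y)` when `Y` has distribution `Q` and `X` is the output of the
posterior channel `W` on input `Y`. -/
def channelMutualInfo (Q : stdSimplex ℝ Y) (W : Channel Y X) : ℝ :=
  mutualInfo fun x y => Q y * W y x

end LossySourceCoding

end

/-! Achievability is soft covering with a likelihood encoder. For a feasible `Q`, draw about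
`2^(n(I+ε))` codewords from `Q^n`. A uniform codeword sent through `W^n` then has, on average over
codebooks, an output law close to `P^n` (`exists_codebook`), because the information density
concentrates around `nI` (`sum_atypical_le`). Encoding by the posterior of the message and decoding
to its codeword would make the backward channel exactly `W^n` if the source had that output law; the
true source costs only the distance between the two laws (`sum_abs_sub_le_of_posterior`).

The converse works with log-likelihood ratios instead of entropies. Since `log t ≤ t - 1`, any test
channel `V` that is positive wherever `P` is has mean log-ratio `log ∏ V/P` at most `log Θ` under a
protocol (`Protocol.sum_inducedDist_mul_logb_le`). A small error allows this mean to be computed, up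
to a factor `n`, from `W` and the position-averaged letter law `Q` (`Protocol.exists_average`). By
compactness the laws `Q` accumulate at a feasible one; with `V = (1-δ)W + δP`, letting `δ → 0`
yields `I ≤ R`.

The minimum exists because on the compact feasible set the mutual information is linear in `Q`. -/

noncomputable section

namespace LossySourceCoding

/-! ### Moments of independent samples on finite alphabets. -/

section FiniteProbability

variable {ι B : Type*} [Fintype ι] [DecidableEq ι] [Fintype B]

theorem sum_pi_prod (F : ι → B → ℝ) : ∑ c : ι → B, ∏ i, F i (c i) = ∏ i, ∑ b, F i b := by
  rw [Finset.prod_univ_sum, Fintype.piFinset_univ]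

/-- The other coordinates integrate to 1. The weights may vary with the index, as needed for the
letters of `W^n` given a word `y^n`. -/
theorem sum_pi_weight_mul_apply {w : ι → B → ℝ} (hw : ∀ i, ∑ b, w i b = 1) (i : ι) (f : B → ℝ) :
    ∑ c : ι → B, (∏ j, w j (c j)) * f (c i) = ∑ b, w i b * f b := by
  have h : ∀ c : ι → B, (∏ j, w j (c j)) * f (c i)
      = ∏ j, (w j (c j) * if j = i then f (c j) else 1) := fun c => by
    rw [Finset.prod_mul_distrib, Finset.prod_ite_eq' Finset.univ i]; simp
  simp_rw [h]
  rw [sum_pi_prod (fun j b => w j b * if j = i then f b else 1), Finset.prod_eq_single i]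
  · simp
  · intro j _ hj; simp [hj, hw]
  · simp

theorem sum_pi_weight_mul_apply_mul_apply {w : ι → B → ℝ} {i j : ι} (hij : i ≠ j)
    (f g : B → ℝ) (hf : ∑ b, w i b * f b = 0) :
    ∑ c : ι → B, (∏ l, w l (c l)) * (f (c i) * g (c j)) = 0 := by
  have h : ∀ c : ι → B, (∏ l, w l (c l)) * (f (c i) * g (c j))
      = ∏ l, (w l (c l) * ((if l = i then f (c l) else 1) * if l = j then g (c l) else 1)) :=
    fun c => by
      rw [Finset.prod_mul_distrib, Finset.prod_mul_distrib, Finset.prod_ite_eq' Finset.univ i,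
        Finset.prod_ite_eq' Finset.univ j]; simp
  simp_rw [h]
  rw [sum_pi_prod (fun l b => w l b * ((if l = i then f b else 1) * if l = j then g b else 1))]
  exact Finset.prod_eq_zero (Finset.mem_univ i) (by simpa [hij] using hf)

theorem sum_pi_weight {w : B → ℝ} (hw : ∑ b, w b = 1) :
    ∑ c : ι → B, ∏ i, w (c i) = 1 := by
  rw [sum_pi_prod (fun _ b => w b)]; simp [hw]

/-- The variance of a sum of independent identically distributed centred variables. -/
theorem sum_pi_weight_mul_sum_sq {w : B → ℝ} (hw : ∑ b, w b = 1) (f : B → ℝ)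
    (hf : ∑ b, w b * f b = 0) :
    ∑ c : ι → B, (∏ i, w (c i)) * (∑ i, f (c i)) ^ 2
      = Fintype.card ι * ∑ b, w b * f b ^ 2 := by
  have h : ∀ c : ι → B, (∏ i, w (c i)) * (∑ i, f (c i)) ^ 2
      = ∑ i, ∑ j, (∏ i, w (c i)) * (f (c i) * f (c j)) := fun c => by
    rw [sq, Finset.sum_mul_sum, Finset.mul_sum]
    simp_rw [Finset.mul_sum]
  simp_rw [h]
  rw [Finset.sum_comm]
  have h2 : ∀ i : ι, ∑ c : ι → B, ∑ j, (∏ i, w (c i)) * (f (c i) * f (c j))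
      = ∑ b, w b * f b ^ 2 := fun i => by
    rw [Finset.sum_comm, Finset.sum_eq_single i]
    · rw [← sum_pi_weight_mul_apply (w := fun _ : ι => w) (fun _ => hw) i (fun b => f b ^ 2)]
      simp_rw [sq]
    · intro j _ hj
      exact sum_pi_weight_mul_apply_mul_apply (w := fun _ : ι => w) hj.symm f f hf
    · simp
  simp [h2]

/-- The probabilistic method: used to extract one good codebook from a random one. -/
theorem exists_le_of_weighted_sum_le {w F : B → ℝ} {t : ℝ} (hw0 : ∀ b, 0 ≤ w b)
    (hw : ∑ b, w b = 1) (h : ∑ b, w b * F b ≤ t) : ∃ b, F b ≤ t := by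
  by_contra! hc
  obtain ⟨b, hb⟩ : ∃ b, 0 < w b := by
    by_contra! h0
    have : ∑ b, w b ≤ 0 := Finset.sum_nonpos fun b _ => h0 b
    linarith
  have : ∑ b, w b * t < ∑ b, w b * F b :=
    Finset.sum_lt_sum (fun b _ => mul_le_mul_of_nonneg_left (hc b).le (hw0 b))
      ⟨b, Finset.mem_univ b, mul_lt_mul_of_pos_left (hc b) hb⟩
  rw [← Finset.sum_mul, hw] at this
  linarith

theorem weighted_sum_abs_le_sqrt {w : B → ℝ} (hw0 : ∀ b, 0 ≤ w b) (hw : ∑ b, w b = 1)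
    (Z : B → ℝ) : ∑ b, w b * |Z b| ≤ √(∑ b, w b * Z b ^ 2) := by
  apply Real.le_sqrt_of_sq_le
  have := Finset.sum_sq_le_sum_mul_sum_of_sq_le_mul Finset.univ (r := fun b => w b * |Z b|)
    (f := w) (g := fun b => w b * Z b ^ 2) (fun b _ => hw0 b)
    (fun b _ => mul_nonneg (hw0 b) (sq_nonneg _)) (fun b _ => by
      rw [mul_pow, sq_abs]; exact le_of_eq (by ring))
  rwa [hw, one_mul] at this

/-- The mean absolute deviation of an empirical average of independent samples. -/
theorem sum_pi_weight_mul_abs_average_sub_le {Θ : ℕ} (hΘ : 0 < Θ) {w : B → ℝ}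
    (hw0 : ∀ b, 0 ≤ w b) (hw : ∑ b, w b = 1) (f : B → ℝ) :
    ∑ c : Fin Θ → B, (∏ m, w (c m)) * |(1 / (Θ : ℝ)) * ∑ m, f (c m) - ∑ b, w b * f b|
      ≤ √((1 / (Θ : ℝ)) * ∑ b, w b * f b ^ 2) := by
  set μ := ∑ b, w b * f b with hμ
  have hΘ' : (0 : ℝ) < Θ := by exact_mod_cast hΘ
  refine (weighted_sum_abs_le_sqrt (fun c => Finset.prod_nonneg fun m _ => hw0 _)
    (sum_pi_weight hw) _).trans (Real.sqrt_le_sqrt ?_)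
  have hc : ∑ b, w b * (f b - μ) = 0 := by
    simp_rw [mul_sub, Finset.sum_sub_distrib, ← Finset.sum_mul, hw, ← hμ]; ring
  have hv : ∑ b, w b * (f b - μ) ^ 2 ≤ ∑ b, w b * f b ^ 2 := by
    have : ∑ b, w b * (f b - μ) ^ 2
        = ∑ b, w b * f b ^ 2 - 2 * μ * (∑ b, w b * f b) + μ ^ 2 * ∑ b, w b := by
      rw [Finset.mul_sum _ _ (2 * μ), Finset.mul_sum _ _ (μ ^ 2), ← Finset.sum_sub_distrib, ← Finset.sum_add_distrib]
      exact Finset.sum_congr rfl fun b _ => by ring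
    rw [this, hw, ← hμ]; nlinarith [sq_nonneg μ]
  have key := sum_pi_weight_mul_sum_sq (ι := Fin Θ) hw (fun b => f b - μ) hc
  have hs : ∀ c : Fin Θ → B, ((1 / (Θ : ℝ)) * ∑ m, f (c m) - μ) ^ 2
      = (1 / (Θ : ℝ)) ^ 2 * (∑ m, (f (c m) - μ)) ^ 2 := fun c => by
    rw [← mul_pow, Finset.sum_sub_distrib]; congr 1; simp; field_simp
  simp_rw [hs, mul_left_comm _ ((1 / (Θ : ℝ)) ^ 2)]
  rw [← Finset.mul_sum, key, Fintype.card_fin]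
  calc _ = (1 / (Θ : ℝ)) * ∑ b, w b * (f b - μ) ^ 2 := by field_simp
    _ ≤ _ := by gcongr

end FiniteProbability

/-! ### One-shot soft covering and the likelihood encoder. -/

section SoftCovering

/-- The likelihood encoder: the posterior of a uniform message given the channel output. -/
theorem exists_posterior {A : Type*} {Θ : ℕ} (hΘ : 0 < Θ) {k : Fin Θ → A → ℝ} (hk : ∀ m a, 0 ≤ k m a) :
    ∃ e : A → stdSimplex ℝ (Fin Θ), ∀ a m, (∑ m', k m' a) * e a m = k m a := by
  have : ∀ a, ∃ e : stdSimplex ℝ (Fin Θ), ∀ m, (∑ m', k m' a) * e m = k m a := fun a => by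
    have hS : 0 ≤ ∑ m', k m' a := Finset.sum_nonneg fun m _ => hk m a
    -- With zero total mass every `k m a` vanishes, so an arbitrary distribution serves; one exists
    -- since `Θ > 0`.
    rcases hS.eq_or_lt with h | h
    · have : Nonempty (Fin Θ) := ⟨⟨0, hΘ⟩⟩
      obtain ⟨e⟩ : Nonempty (stdSimplex ℝ (Fin Θ)) := inferInstance
      refine ⟨e, fun m => ?_⟩
      rw [← h, zero_mul]
      exact ((Finset.sum_eq_zero_iff_of_nonneg fun m _ => hk m a).1 h.symm m
        (Finset.mem_univ m)).symm
    · refine ⟨⟨fun m => k m a / ∑ m', k m' a, fun m => div_nonneg (hk m a) hS, ?_⟩, fun m => ?_⟩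
      · rw [← Finset.sum_div, div_self h.ne']
      · exact mul_div_cancel₀ _ h.ne'
  choose e he using this
  exact ⟨e, he⟩

variable {A B : Type*} [Fintype A] [Fintype B]

open Classical in
/-- One-shot soft covering: some codebook makes the output of the channel `K` close to `p`. -/
theorem exists_codebook {q : B → ℝ} (hq0 : ∀ b, 0 ≤ q b) (hq : ∑ b, q b = 1)
    {K : B → A → ℝ} (hK0 : ∀ b a, 0 ≤ K b a) {p : A → ℝ} (hp1 : ∑ a, p a = 1)
    (hp : ∀ a, ∑ b, q b * K b a = p a) {L : ℝ} (hL : 0 ≤ L) {Θ : ℕ} (hΘ : 0 < Θ) :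
    ∃ c : Fin Θ → B, ∑ a, |(1 / (Θ : ℝ)) * ∑ m, K (c m) a - p a|
      ≤ √(L / Θ) + 2 * ∑ a, ∑ b, if L * p a < K b a then q b * K b a else 0 := by
  have hΘ' : (0 : ℝ) < Θ := by exact_mod_cast hΘ
  have hp0 : ∀ a, 0 ≤ p a := fun a => by
    rw [← hp a]; exact Finset.sum_nonneg fun b _ => mul_nonneg (hq0 b) (hK0 b a)
  have hw0 : ∀ c : Fin Θ → B, 0 ≤ ∏ m, q (c m) := fun c => Finset.prod_nonneg fun m _ => hq0 _
  refine exists_le_of_weighted_sum_le hw0 (sum_pi_weight hq) ?_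
  simp_rw [Finset.mul_sum Finset.univ _ (∏ _, _)]
  rw [Finset.sum_comm]
  -- Truncate at likelihood ratio `L`: the part `K₁` has second moment at most `L * p a ^ 2`, so the
  -- variance bound applies; for the atypical part `K₂` the triangle inequality gives twice its
  -- mean.
  set K₁ : A → B → ℝ := fun a b => if L * p a < K b a then 0 else K b a with hK₁
  set K₂ : A → B → ℝ := fun a b => if L * p a < K b a then K b a else 0 with hK₂
  have hK : ∀ a b, K b a = K₁ a b + K₂ a b := fun a b => by
    simp only [hK₁, hK₂]; split_ifs <;> simp
  have hK₁0 : ∀ a b, 0 ≤ K₁ a b := fun a b => by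
    simp only [hK₁]; split_ifs; exacts [le_rfl, hK0 b a]
  have hK₂0 : ∀ a b, 0 ≤ K₂ a b := fun a b => by
    simp only [hK₂]; split_ifs; exacts [hK0 b a, le_rfl]
  have h₁ : ∀ a, ∑ c : Fin Θ → B, (∏ m, q (c m)) *
      |(1 / (Θ : ℝ)) * ∑ m, K₁ a (c m) - ∑ b, q b * K₁ a b| ≤ √(L / Θ) * p a := fun a => by
    refine (sum_pi_weight_mul_abs_average_sub_le hΘ hq0 hq (K₁ a)).trans ?_
    have : ∑ b, q b * K₁ a b ^ 2 ≤ L * p a * p a := by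
      calc ∑ b, q b * K₁ a b ^ 2 ≤ ∑ b, L * p a * (q b * K b a) := by
            refine Finset.sum_le_sum fun b _ => ?_
            simp only [hK₁]
            split_ifs with h
            · simpa using mul_nonneg (mul_nonneg hL (hp0 a)) (mul_nonneg (hq0 b) (hK0 b a))
            · push Not at h
              nlinarith [mul_nonneg (mul_nonneg (hq0 b) (hK0 b a)) (sub_nonneg.2 h)]
        _ = L * p a * p a := by rw [← Finset.mul_sum, hp]
    calc _ ≤ √(L / Θ * p a ^ 2) := by
          apply Real.sqrt_le_sqrt
          calc _ ≤ (1 / (Θ : ℝ)) * (L * p a * p a) := by gcongr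
            _ = _ := by ring
      _ = _ := by rw [Real.sqrt_mul (by positivity), Real.sqrt_sq (hp0 a)]
  have h₂ : ∀ a, ∑ c : Fin Θ → B, (∏ m, q (c m)) *
      |(1 / (Θ : ℝ)) * ∑ m, K₂ a (c m) - ∑ b, q b * K₂ a b| ≤ 2 * ∑ b, q b * K₂ a b := fun a => by
    have hμ0 : 0 ≤ ∑ b, q b * K₂ a b :=
      Finset.sum_nonneg fun b _ => mul_nonneg (hq0 b) (hK₂0 a b)
    have hmean : ∑ c : Fin Θ → B, (∏ m, q (c m)) * ((1 / (Θ : ℝ)) * ∑ m, K₂ a (c m))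
        = ∑ b, q b * K₂ a b := by
      simp_rw [mul_left_comm _ (1 / (Θ : ℝ)), Finset.mul_sum Finset.univ _ (∏ _, _)]
      rw [← Finset.mul_sum, Finset.sum_comm]
      simp_rw [fun m => sum_pi_weight_mul_apply (w := fun _ : Fin Θ => q) (fun _ => hq) m (K₂ a)]
      simp
      field_simp
    calc _ ≤ ∑ c : Fin Θ → B, ((∏ m, q (c m)) * ((1 / (Θ : ℝ)) * ∑ m, K₂ a (c m))
            + (∏ m, q (c m)) * ∑ b, q b * K₂ a b) := by
          refine Finset.sum_le_sum fun c _ => ?_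
          rw [← mul_add]
          refine mul_le_mul_of_nonneg_left ?_ (hw0 c)
          have : 0 ≤ (1 / (Θ : ℝ)) * ∑ m, K₂ a (c m) :=
            mul_nonneg (by positivity) (Finset.sum_nonneg fun m _ => hK₂0 a _)
          rw [abs_le]; constructor <;> linarith
      _ = _ := by
          rw [Finset.sum_add_distrib, hmean, ← Finset.sum_mul, sum_pi_weight hq]; ring
  calc _ ≤ ∑ a, (√(L / Θ) * p a + 2 * ∑ b, q b * K₂ a b) := by
        refine Finset.sum_le_sum fun a _ => ?_
        refine le_trans ?_ (add_le_add (h₁ a) (h₂ a))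
        rw [← Finset.sum_add_distrib]
        refine Finset.sum_le_sum fun c _ => ?_
        rw [← mul_add]
        refine mul_le_mul_of_nonneg_left ?_ (hw0 c)
        refine le_trans (le_of_eq ?_) (abs_add_le _ _)
        congr 1
        rw [← hp a]
        simp_rw [hK, mul_add, Finset.sum_add_distrib]
        ring
    _ = _ := by
        rw [Finset.sum_add_distrib, ← Finset.mul_sum, hp1, mul_one, ← Finset.mul_sum]
        simp [hK₂]

/-- Replacing the source `p` by the codebook output law `s` gives a joint law `J'` whose backward
channel is exactly `K`. The distance from `s` to `p` is then paid twice, once for the joint law and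
once for its marginal. -/
theorem sum_abs_sub_le_of_posterior {Θ : ℕ} {K : B → A → ℝ}
    (hK0 : ∀ b a, 0 ≤ K b a) (hK : ∀ b, ∑ a, K b a = 1) (p : A → ℝ) (c : Fin Θ → B)
    (e : A → stdSimplex ℝ (Fin Θ))
    (he : ∀ a m, (∑ m', K (c m') a) * e a m = K (c m) a)
    (D : Fin Θ → stdSimplex ℝ B) (hD : ∀ m b, b ≠ c m → D m b = 0) :
    ∑ a, ∑ b, |p a * ∑ m, e a m * D m b
        - (∑ a', p a' * ∑ m, e a' m * D m b) * K b a|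
      ≤ 2 * ∑ a, |(1 / (Θ : ℝ)) * ∑ m, K (c m) a - p a| := by
  set s : A → ℝ := fun a => (1 / (Θ : ℝ)) * ∑ m, K (c m) a with hs
  set J : A → B → ℝ := fun a b => p a * ∑ m, e a m * D m b with hJ
  set J' : A → B → ℝ := fun a b => s a * ∑ m, e a m * D m b with hJ'
  have hJ'2 : ∀ a b, J' a b = (1 / (Θ : ℝ)) * (∑ m, D m b) * K b a := fun a b => by
    simp only [hJ', hs]
    rw [mul_assoc, Finset.mul_sum, mul_assoc, Finset.sum_mul]
    congr 1
    refine Finset.sum_congr rfl fun m _ => ?_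
    rw [← mul_assoc, he]
    -- The decoder puts no mass off the codeword, so `K (c m)` may be read as `K b`.
    by_cases h : b = c m
    · rw [h, mul_comm]
    · simp [hD m b h]
  have hJ'Y : ∀ b, ∑ a, J' a b = (1 / (Θ : ℝ)) * ∑ m, D m b := fun b => by
    simp_rw [hJ'2, ← Finset.mul_sum, hK, mul_one]
  have hd : ∑ a, ∑ b, |J' a b - J a b| = ∑ a, |s a - p a| := by
    refine Finset.sum_congr rfl fun a _ => ?_
    have h0 : ∀ b, 0 ≤ ∑ m, e a m * D m b := fun b =>
      Finset.sum_nonneg fun m _ => mul_nonneg (stdSimplex.zero_le _ _) (stdSimplex.zero_le _ _)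
    simp only [hJ, hJ', ← sub_mul, abs_mul]
    simp_rw [fun b => abs_of_nonneg (h0 b), ← Finset.mul_sum]
    rw [Finset.sum_comm]
    simp_rw [← Finset.mul_sum, stdSimplex.sum_eq_one, mul_one, stdSimplex.sum_eq_one, mul_one]
  calc _ ≤ ∑ a, ∑ b, (|J' a b - J a b| + |∑ a', (J' a' b - J a' b)| * K b a) := by
        refine Finset.sum_le_sum fun a _ => Finset.sum_le_sum fun b _ => ?_
        have h1 : J a b - (∑ a', J a' b) * K b a
            = -(J' a b - J a b) + (∑ a', (J' a' b - J a' b)) * K b a := by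
          rw [Finset.sum_sub_distrib, hJ'Y, sub_mul, ← hJ'2]; ring
        calc _ = |J a b - (∑ a', J a' b) * K b a| := rfl
          _ ≤ _ := by
            rw [h1]
            refine (abs_add_le _ _).trans ?_
            rw [abs_neg, abs_mul, abs_of_nonneg (hK0 b a)]
    _ = ∑ a, |s a - p a| + ∑ b, |∑ a', (J' a' b - J a' b)| := by
        simp_rw [Finset.sum_add_distrib]
        rw [hd]
        congr 1
        rw [Finset.sum_comm]
        simp_rw [← Finset.mul_sum, hK, mul_one]
    _ ≤ ∑ a, |s a - p a| + ∑ b, ∑ a', |J' a' b - J a' b| := by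
        gcongr with b _
        exact Finset.abs_sum_le_sum_abs _ _
    _ = _ := by rw [Finset.sum_comm, hd]; ring

end SoftCovering

/-! ### Mutual information on the feasible set. -/

section MutualInformation

variable {X Y : Type*} [Fintype X] [Fintype Y] {P : stdSimplex ℝ X} {W : Channel Y X}
  {Q : stdSimplex ℝ Y}

theorem pos_of_mem_feasibleSet (hQ : Q ∈ feasibleSet P W) {x : X} {y : Y}
    (h : Q y * W y x ≠ 0) : 0 < P x := by
  rw [← hQ x]
  have h0 : ∀ y, 0 ≤ Q y * W y x := fun y =>
    mul_nonneg (stdSimplex.zero_le _ _) (stdSimplex.zero_le _ _)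
  exact Finset.sum_pos' (fun y _ => h0 y) ⟨y, Finset.mem_univ y, (h0 y).lt_of_ne' h⟩

/-- On the feasible set the mutual information is linear in the reconstruction distribution. -/
theorem channelMutualInfo_eq (hQ : Q ∈ feasibleSet P W) :
    channelMutualInfo Q W = ∑ y, Q y * ∑ x, W y x * Real.logb 2 (W y x / P x) := by
  unfold channelMutualInfo mutualInfo
  rw [Finset.sum_comm]
  refine Finset.sum_congr rfl fun y _ => ?_
  rw [Finset.mul_sum]
  refine Finset.sum_congr rfl fun x _ => ?_
  rw [hQ x, ← Finset.mul_sum, stdSimplex.sum_eq_one, mul_one, ← mul_assoc]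
  by_cases h : Q y = 0
  · simp [h]
  · rw [mul_comm (P x), mul_div_mul_left _ _ h]

theorem continuous_stdSimplex_apply (y : Y) : Continuous fun Q : stdSimplex ℝ Y => Q y :=
  (continuous_apply y).comp continuous_subtype_val

theorem isCompact_feasibleSet : IsCompact (feasibleSet P W) := by
  refine IsClosed.isCompact ?_
  have : feasibleSet P W = ⋂ x, {Q : stdSimplex ℝ Y | ∑ y, Q y * W y x = P x} := by
    ext Q; simp [feasibleSet]
  rw [this]
  refine isClosed_iInter fun x => isClosed_eq ?_ continuous_const
  exact continuous_finsetSum _ fun y _ => (continuous_stdSimplex_apply y).mul_const _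

/-- `channelMutualInfo_eq` removes `Q` from the logarithm, so continuity on the feasible set is that
of a linear function. -/
theorem exists_isMinOn_channelMutualInfo (h : (feasibleSet P W).Nonempty) :
    ∃ Q ∈ feasibleSet P W, IsMinOn (fun Q => channelMutualInfo Q W) (feasibleSet P W) Q := by
  refine isCompact_feasibleSet.exists_isMinOn h ?_
  refine ContinuousOn.congr (Continuous.continuousOn ?_) fun Q hQ => channelMutualInfo_eq hQ
  exact continuous_finsetSum _ fun y _ => (continuous_stdSimplex_apply y).mul_const _

theorem channelMutualInfo_nonneg (hQ : Q ∈ feasibleSet P W) : 0 ≤ channelMutualInfo Q W := by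
  have hl : 0 < Real.log 2 := Real.log_pos one_lt_two
  have key : ∀ y x, Q y * (W y x - P x) ≤
      Q y * (W y x * Real.logb 2 (W y x / P x)) * Real.log 2 := fun y x => by
    have hq := stdSimplex.zero_le Q y
    have hp := stdSimplex.zero_le P x
    by_cases h : Q y * W y x = 0
    · rw [← mul_assoc, h]
      nlinarith [mul_nonneg hq hp]
    · have hP := pos_of_mem_feasibleSet hQ h
      have hW : 0 < W y x := (stdSimplex.zero_le _ _).lt_of_ne' (right_ne_zero_of_mul h)
      have h1 : Real.logb 2 (W y x / P x) * Real.log 2 = - Real.log (P x / W y x) := by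
        rw [Real.logb, div_mul_cancel₀ _ hl.ne', ← Real.log_inv, inv_div]
      rw [mul_assoc, mul_assoc, h1]
      refine mul_le_mul_of_nonneg_left ?_ hq
      have h2 := Real.log_le_sub_one_of_pos (div_pos hP hW)
      have h3 : W y x * (P x / W y x) = P x := mul_div_cancel₀ _ hW.ne'
      nlinarith
  refine nonneg_of_mul_nonneg_left ?_ hl
  rw [channelMutualInfo_eq hQ]
  simp_rw [Finset.mul_sum, Finset.sum_mul]
  calc (0 : ℝ) = ∑ y, ∑ x, Q y * (W y x - P x) := by
        simp_rw [← Finset.mul_sum, Finset.sum_sub_distrib, stdSimplex.sum_eq_one]; simp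
    _ ≤ _ := Finset.sum_le_sum fun y _ => Finset.sum_le_sum fun x _ => key y x

end MutualInformation

/-! ### Product sources and product channels. -/

section ProductDistributions

variable {X Y : Type*} [Fintype X] (P : stdSimplex ℝ X) (W : Channel Y X) {n : ℕ}

theorem iidDist_nonneg (x : Fin n → X) : 0 ≤ iidDist P n x :=
  Finset.prod_nonneg fun _ _ => stdSimplex.zero_le _ _

theorem iidChannel_nonneg (y : Fin n → Y) (x : Fin n → X) : 0 ≤ iidChannel W n y x :=
  Finset.prod_nonneg fun _ _ => stdSimplex.zero_le _ _

theorem sum_iidDist : ∑ x, iidDist P n x = 1 :=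
  sum_pi_weight (stdSimplex.sum_eq_one P)

theorem sum_iidChannel (y : Fin n → Y) : ∑ x, iidChannel W n y x = 1 := by
  unfold iidChannel
  rw [sum_pi_prod (fun i x => W (y i) x)]
  simp [stdSimplex.sum_eq_one]

theorem sum_iidDist_mul_iidChannel [Fintype Y] {P : stdSimplex ℝ X} {W : Channel Y X} {Q : stdSimplex ℝ Y}
    (hQ : Q ∈ feasibleSet P W) (x : Fin n → X) :
    ∑ y, iidDist Q n y * iidChannel W n y x = iidDist P n x := by
  unfold iidDist iidChannel
  simp_rw [← Finset.prod_mul_distrib]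
  rw [sum_pi_prod (fun i y => Q y * W y (x i))]
  exact Finset.prod_congr rfl fun i _ => hQ (x i)

end ProductDistributions

/-! ### Converse: an achievable rate dominates some feasible mutual information. -/

section Converse

variable {X Y : Type*} [Fintype X] [Fintype Y] {P : stdSimplex ℝ X} {n Θ : ℕ}
  (C : Protocol X Y n Θ)

theorem Protocol.sum_encoder_mul_decoder_nonneg (x : Fin n → X) (y : Fin n → Y) :
    0 ≤ ∑ m, C.encoder x m * C.decoder m y :=
  Finset.sum_nonneg fun _ _ => mul_nonneg (stdSimplex.zero_le _ _) (stdSimplex.zero_le _ _)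

theorem Protocol.inducedDist_nonneg (x : Fin n → X) (y : Fin n → Y) :
    0 ≤ C.inducedDist P x y :=
  mul_nonneg (iidDist_nonneg P x) (C.sum_encoder_mul_decoder_nonneg x y)

theorem Protocol.sum_inducedDist (x : Fin n → X) :
    ∑ y, C.inducedDist P x y = iidDist P n x := by
  unfold Protocol.inducedDist
  rw [← Finset.mul_sum, Finset.sum_comm]
  simp_rw [← Finset.mul_sum, stdSimplex.sum_eq_one, mul_one, stdSimplex.sum_eq_one, mul_one]

theorem Protocol.sum_reconstructionDist : ∑ y, C.reconstructionDist P y = 1 := by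
  unfold Protocol.reconstructionDist
  rw [Finset.sum_comm]
  simp_rw [C.sum_inducedDist, sum_iidDist]

theorem Protocol.reconstructionDist_nonneg (y : Fin n → Y) : 0 ≤ C.reconstructionDist P y :=
  Finset.sum_nonneg fun _ _ => C.inducedDist_nonneg _ _

theorem Protocol.size_pos {n Θ : ℕ} (C : Protocol X Y n Θ) (P : stdSimplex ℝ X) : 0 < Θ := by
  have hX : Nonempty X := by
    by_contra h
    rw [not_nonempty_iff] at h
    simpa using stdSimplex.sum_eq_one P
  obtain ⟨a⟩ := hX
  rcases Nat.eq_zero_or_pos Θ with h | h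
  · subst h
    simpa using stdSimplex.sum_eq_one (C.encoder fun _ => a)
  · exact h

/-- The mean log-likelihood ratio of any channel against the source is at most `log Θ`. -/
theorem Protocol.sum_inducedDist_mul_logb_le {V : Y → X → ℝ} (hV0 : ∀ y x, 0 ≤ V y x)
    (hV : ∀ y, ∑ x, V y x = 1) (hVP : ∀ y x, 0 < P x → 0 < V y x) :
    ∑ x, ∑ y, C.inducedDist P x y * ∑ i, Real.logb 2 (V (y i) (x i) / P (x i))
      ≤ Real.logb 2 Θ := by
  have hl : 0 < Real.log 2 := Real.log_pos one_lt_two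
  have hΘ : (0 : ℝ) < Θ := by exact_mod_cast C.size_pos P
  have key : ∀ x y, C.inducedDist P x y *
        (∑ i, Real.logb 2 (V (y i) (x i) / P (x i)) - Real.logb 2 Θ) * Real.log 2
      ≤ (1 / (Θ : ℝ)) * (∑ m, C.decoder m y) * (∏ i, V (y i) (x i))
        - C.inducedDist P x y := fun x y => by
    have hr : 0 ≤ (1 / (Θ : ℝ)) * (∑ m, C.decoder m y) * (∏ i, V (y i) (x i)) :=
      mul_nonneg (mul_nonneg (by positivity) (Finset.sum_nonneg fun _ _ => stdSimplex.zero_le _ _))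
        (Finset.prod_nonneg fun i _ => hV0 _ _)
    rcases (C.inducedDist_nonneg (P := P) x y).eq_or_lt with h | h
    · rw [← h]; simpa using hr
    have hPn : iidDist P n x ≠ 0 := fun h0 => by
      rw [Protocol.inducedDist, h0, zero_mul] at h; exact lt_irrefl _ h
    have hP : ∀ i, 0 < P (x i) := fun i =>
      (stdSimplex.zero_le _ _).lt_of_ne' (Finset.prod_ne_zero_iff.1 hPn i (Finset.mem_univ i))
    have hg : ∀ i, 0 < V (y i) (x i) / P (x i) := fun i => div_pos (hVP _ _ (hP i)) (hP i)
    have hg' : 0 < (∏ i, V (y i) (x i) / P (x i)) / Θ :=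
      div_pos (Finset.prod_pos fun i _ => hg i) hΘ
    have h1 : (∑ i, Real.logb 2 (V (y i) (x i) / P (x i)) - Real.logb 2 Θ) * Real.log 2
        = Real.log ((∏ i, V (y i) (x i) / P (x i)) / Θ) := by
      rw [Real.log_div (Finset.prod_pos fun i _ => hg i).ne' hΘ.ne',
        Real.log_prod fun i _ => (hg i).ne', sub_mul, Finset.sum_mul]
      simp only [Real.logb, div_mul_cancel₀ _ hl.ne']
    rw [mul_assoc, h1]
    have h2 := mul_le_mul_of_nonneg_left (Real.log_le_sub_one_of_pos hg') h.le
    refine h2.trans ?_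
    rw [mul_sub, mul_one]
    refine sub_le_sub_right ?_ _
    -- Bounding the encoder by 1 is where `Θ` enters: what remains, divided by `Θ` and multiplied by
    -- `V^n / P^n`, is a probability law.
    have h3 : C.inducedDist P x y ≤ iidDist P n x * ∑ m, C.decoder m y := by
      refine mul_le_mul_of_nonneg_left (Finset.sum_le_sum fun m _ => ?_) (iidDist_nonneg P x)
      exact mul_le_of_le_one_left (stdSimplex.zero_le _ _) (stdSimplex.le_one _ _)
    refine (mul_le_mul_of_nonneg_right h3 hg'.le).trans (le_of_eq ?_)
    rw [Finset.prod_div_distrib]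
    change _ * _ * (_ / iidDist P n x / _) = _
    field_simp
  have hsum := Finset.sum_le_sum fun x (_ : x ∈ Finset.univ) =>
    Finset.sum_le_sum fun y (_ : y ∈ Finset.univ) => key x y
  have hJ : ∑ x, ∑ y, C.inducedDist P x y = 1 := by
    simp_rw [C.sum_inducedDist, sum_iidDist]
  have hprod : ∑ x : Fin n → X, ∑ y, (1 / (Θ : ℝ)) * (∑ m, C.decoder m y) * ∏ i, V (y i) (x i)
      = 1 := by
    rw [Finset.sum_comm]
    simp_rw [← Finset.mul_sum, fun y : Fin n → Y => sum_pi_prod (fun i x => V (y i) x), hV]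
    simp only [Finset.prod_const_one, mul_one]
    rw [← Finset.mul_sum, Finset.sum_comm]
    simp_rw [stdSimplex.sum_eq_one]
    simp [hΘ.ne']
  have hleft : ∑ x, ∑ y, C.inducedDist P x y *
        (∑ i, Real.logb 2 (V (y i) (x i) / P (x i)) - Real.logb 2 Θ) * Real.log 2
      = (∑ x, ∑ y, C.inducedDist P x y * ∑ i, Real.logb 2 (V (y i) (x i) / P (x i))
        - Real.logb 2 Θ) * Real.log 2 := by
    simp_rw [← Finset.sum_mul, mul_sub (C.inducedDist P _ _), Finset.sum_sub_distrib,
      ← Finset.sum_mul, hJ, one_mul]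
  simp_rw [Finset.sum_sub_distrib] at hsum
  rw [hprod, hJ, hleft, sub_self] at hsum
  linarith [nonpos_of_mul_nonpos_left hsum hl]

open Classical in
/-- The single-letter reconstruction distribution, averaged over the positions. -/
theorem Protocol.exists_average (hn : 0 < n) (W : Channel Y X) :
    ∃ Q : stdSimplex ℝ Y, ∀ (h : X → Y → ℝ) (H : ℝ), (∀ x y, |h x y| ≤ H) →
      |(1 / (n : ℝ)) * (∑ x, ∑ y, C.inducedDist P x y * ∑ i, h (x i) (y i))
        - ∑ y, Q y * ∑ x, W y x * h x y| ≤ 2 * H * C.error P W := by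
  have hn' : (0 : ℝ) < n := by exact_mod_cast hn
  have hmean : ∀ f : Y → ℝ, ∑ b, ((1 / (n : ℝ)) * ∑ i, ∑ y : Fin n → Y,
        C.reconstructionDist P y * if y i = b then 1 else 0) * f b
      = (1 / (n : ℝ)) * ∑ i, ∑ y, C.reconstructionDist P y * f (y i) := fun f => by
    simp_rw [mul_assoc, ← Finset.mul_sum, Finset.sum_mul]
    rw [Finset.sum_comm]
    congr 1
    refine Finset.sum_congr rfl fun i _ => ?_
    rw [Finset.sum_comm]
    refine Finset.sum_congr rfl fun y _ => ?_
    simp_rw [mul_assoc, ← Finset.mul_sum]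
    simp
  refine ⟨⟨fun b => (1 / (n : ℝ)) * ∑ i, ∑ y : Fin n → Y,
    C.reconstructionDist P y * if y i = b then 1 else 0, fun b => ?_, ?_⟩, fun h H hH => ?_⟩
  · refine mul_nonneg (by positivity) (Finset.sum_nonneg fun i _ => Finset.sum_nonneg fun y _ =>
      mul_nonneg (C.reconstructionDist_nonneg y) ?_)
    split_ifs <;> norm_num
  · have := hmean fun _ => 1
    simp only [mul_one, C.sum_reconstructionDist] at this
    rw [this]
    simp [hn'.ne']
  · have h1 := hmean fun b => ∑ x, W b x * h x b
    change |_ - ∑ b, ((1 / (n : ℝ)) * ∑ i, ∑ y : Fin n → Y,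
      C.reconstructionDist P y * if y i = b then 1 else 0) * _| ≤ _
    rw [h1]
    -- Given `y`, the letter `x i` has law `W (y i)` under the product channel.
    have h2 : ∀ i : Fin n, ∑ y, C.reconstructionDist P y * ∑ x, W (y i) x * h x (y i)
        = ∑ x : Fin n → X, ∑ y, C.reconstructionDist P y * iidChannel W n y x * h (x i) (y i) :=
      fun i => by
        rw [Finset.sum_comm]
        refine Finset.sum_congr rfl fun y _ => ?_
        simp_rw [mul_assoc, ← Finset.mul_sum]
        congr 1
        exact (sum_pi_weight_mul_apply (w := fun i => W (y i))
          (fun j => stdSimplex.sum_eq_one _) i (fun x => h x (y i))).symm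
    simp_rw [h2]
    have h3 : ∑ i : Fin n, ∑ x : Fin n → X, ∑ y : Fin n → Y,
          C.reconstructionDist P y * iidChannel W n y x * h (x i) (y i)
        = ∑ x : Fin n → X, ∑ y : Fin n → Y,
          C.reconstructionDist P y * iidChannel W n y x * ∑ i, h (x i) (y i) := by
      rw [Finset.sum_comm]
      refine Finset.sum_congr rfl fun x _ => ?_
      rw [Finset.sum_comm]
      simp_rw [Finset.mul_sum]
    rw [h3, ← mul_sub, ← Finset.sum_sub_distrib, abs_mul, abs_of_pos (by positivity)]
    simp_rw [← Finset.sum_sub_distrib, ← sub_mul]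
    have h4 : ∀ (x : Fin n → X) (y : Fin n → Y), |∑ i, h (x i) (y i)| ≤ n * H := fun x y => by
      refine (Finset.abs_sum_le_sum_abs _ _).trans ?_
      refine (Finset.sum_le_sum fun i _ => hH (x i) (y i)).trans ?_
      simp
    calc _ ≤ (1 / (n : ℝ)) * ∑ x : Fin n → X, ∑ y : Fin n → Y,
          |C.inducedDist P x y - C.reconstructionDist P y * iidChannel W n y x| * (n * H) := by
          refine mul_le_mul_of_nonneg_left ?_ (by positivity)
          refine (Finset.abs_sum_le_sum_abs _ _).trans (Finset.sum_le_sum fun x _ => ?_)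
          refine (Finset.abs_sum_le_sum_abs _ _).trans (Finset.sum_le_sum fun y _ => ?_)
          rw [abs_mul]
          exact mul_le_mul_of_nonneg_left (h4 x y) (abs_nonneg _)
      _ = _ := by
          simp_rw [← Finset.sum_mul]
          unfold Protocol.error
          field_simp

open Classical in
-- With `Protocol.exists_average` applied to the indicator of `a`, this shows that the averaged law
-- is feasible up to the error.
theorem Protocol.average_letter_frequency (hn : 0 < n) (a : X) :
    (1 / (n : ℝ)) * (∑ x, ∑ y, C.inducedDist P x y * ∑ i, if x i = a then 1 else 0) = P a := by
  have hn' : (n : ℝ) ≠ 0 := by exact_mod_cast hn.ne'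
  simp_rw [← Finset.sum_mul, C.sum_inducedDist, Finset.mul_sum Finset.univ _ (iidDist P n _)]
  rw [Finset.sum_comm]
  have : ∀ i : Fin n, ∑ x : Fin n → X, iidDist P n x * (if x i = a then 1 else 0) = P a :=
    fun i => by
      rw [show P a = ∑ b, P b * if b = a then 1 else 0 by simp]
      exact sum_pi_weight_mul_apply (w := fun _ => P) (fun j => stdSimplex.sum_eq_one _) i
        (fun b => if b = a then 1 else 0)
  rw [Finset.sum_congr rfl fun i _ => this i]
  simp [hn']

theorem IsAchievable.exists_feasible {W : Channel Y X} {R : ℝ} (hR : IsAchievable P W R) :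
    ∃ Q ∈ feasibleSet P W, channelMutualInfo Q W ≤ R := by
  classical
  -- Mixing in `P` makes the test channel positive wherever `P` is, even if `W` has zeros.
  set V : ℝ → Y → X → ℝ := fun δ y x => (1 - δ) * W y x + δ * P x with hVdef
  set h : ℝ → X → Y → ℝ := fun δ x y => Real.logb 2 (V δ y x / P x) with hh
  set H : ℝ → ℝ := fun δ => ∑ x, ∑ y, |h δ x y| with hHdef
  have hH : ∀ δ x y, |h δ x y| ≤ H δ := fun δ x y =>
    (Finset.single_le_sum (f := fun y => |h δ x y|) (fun _ _ => abs_nonneg _)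
      (Finset.mem_univ y)).trans
    (Finset.single_le_sum (f := fun x => ∑ y, |h δ x y|)
      (fun _ _ => Finset.sum_nonneg fun _ _ => abs_nonneg _) (Finset.mem_univ x))
  -- `Q` is chosen before `δ`, so a single limit law serves every `δ`.
  have step : ∀ ε : ℝ, 0 < ε → ∃ Q : stdSimplex ℝ Y,
      (∀ a, |P a - ∑ y, Q y * W y a| ≤ 2 * ε) ∧
      ∀ δ, 0 < δ → δ < 1 →
        ∑ y, Q y * ∑ x, W y x * h δ x y ≤ R + ε + 2 * H δ * ε := fun ε hε => by
    obtain ⟨n, ⟨Θ, C, hrate, herr⟩, hn⟩ := ((hR ε hε).and (eventually_gt_atTop 0)).exists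
    have hn' : (0 : ℝ) < n := by exact_mod_cast hn
    obtain ⟨Q, hQ⟩ := C.exists_average (P := P) hn W
    refine ⟨Q, fun a => ?_, fun δ hδ hδ1 => ?_⟩
    · have := hQ (fun x _ => if x = a then 1 else 0) 1 (fun x y => by split_ifs <;> simp)
      rw [C.average_letter_frequency hn] at this
      simp only [mul_ite, mul_one, mul_zero, Finset.sum_ite_eq', Finset.mem_univ, if_true] at this
      linarith
    · have h1 := (abs_le.1 (hQ (h δ) (H δ) (hH δ))).1
      have h2 := C.sum_inducedDist_mul_logb_le (P := P) (V := V δ)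
        (fun y x => add_nonneg (mul_nonneg (by linarith) (stdSimplex.zero_le _ _))
          (mul_nonneg hδ.le (stdSimplex.zero_le _ _)))
        (fun y => by
          simp only [hVdef, Finset.sum_add_distrib, ← Finset.mul_sum, stdSimplex.sum_eq_one]; ring)
        (fun y x hx => add_pos_of_nonneg_of_pos
          (mul_nonneg (by linarith) (stdSimplex.zero_le _ _)) (mul_pos hδ hx))
      have h3 := mul_le_mul_of_nonneg_left h2 (by positivity : (0 : ℝ) ≤ 1 / n)
      have hH0 : 0 ≤ H δ := Finset.sum_nonneg fun _ _ => Finset.sum_nonneg fun _ _ => abs_nonneg _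
      have h4 : 2 * H δ * C.error P W ≤ 2 * H δ * ε := by gcongr
      linarith
  choose q hq using step
  set u : ℕ → ℝ := fun k => 1 / ((k : ℝ) + 1) with hu
  have hu0 : ∀ k, 0 < u k := fun k => by simp only [hu]; positivity
  obtain ⟨Q, φ, hφ, hlim⟩ := CompactSpace.tendsto_subseq fun k => q (u k) (hu0 k)
  have hut : Tendsto (u ∘ φ) atTop (nhds 0) :=
    tendsto_one_div_add_atTop_nhds_zero_nat.comp hφ.tendsto_atTop
  have hlin : ∀ f : Y → ℝ, Tendsto (fun k => ∑ y, q (u (φ k)) (hu0 (φ k)) y * f y) atTop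
      (nhds (∑ y, Q y * f y)) := fun f =>
    tendsto_finsetSum _ fun y _ =>
      (((continuous_stdSimplex_apply y).tendsto Q).comp hlim).mul_const _
  have hfeas : Q ∈ feasibleSet P W := fun a => by
    have h1 : Tendsto (fun k => |P a - ∑ y, q (u (φ k)) (hu0 (φ k)) y * W y a|) atTop
        (nhds |P a - ∑ y, Q y * W y a|) := ((hlin fun y => W y a).const_sub (P a)).abs
    have h2 : Tendsto (fun k => 2 * (u ∘ φ) k) atTop (nhds (2 * 0)) := hut.const_mul 2
    have h3 := le_of_tendsto_of_tendsto' h1 h2 fun k => (hq _ (hu0 (φ k))).1 a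
    rw [mul_zero] at h3
    have := abs_nonpos_iff.1 h3
    linarith
  refine ⟨Q, hfeas, ?_⟩
  have hδ : ∀ δ : ℝ, 0 < δ → δ < 1 → channelMutualInfo Q W + Real.logb 2 (1 - δ) ≤ R :=
    fun δ hδ hδ1 => by
      have h2 : Tendsto (fun k => R + (u ∘ φ) k + 2 * H δ * (u ∘ φ) k) atTop
          (nhds (R + 0 + 2 * H δ * 0)) := (hut.const_add R).add (hut.const_mul _)
      have h3 := le_of_tendsto_of_tendsto' (hlin fun y => ∑ x, W y x * h δ x y) h2
        fun k => (hq _ (hu0 (φ k))).2 δ hδ hδ1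
      rw [mul_zero, add_zero, add_zero] at h3
      refine le_trans ?_ h3
      have hc : Real.logb 2 (1 - δ) = ∑ y, Q y * ∑ x, W y x * Real.logb 2 (1 - δ) := by
        simp_rw [← Finset.sum_mul, stdSimplex.sum_eq_one, one_mul, ← Finset.sum_mul,
          stdSimplex.sum_eq_one, one_mul]
      rw [channelMutualInfo_eq hfeas, hc, ← Finset.sum_add_distrib]
      refine Finset.sum_le_sum fun y _ => ?_
      rw [← mul_add, ← Finset.sum_add_distrib, Finset.mul_sum, Finset.mul_sum]
      refine Finset.sum_le_sum fun x _ => ?_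
      rw [← mul_add, ← mul_assoc, ← mul_assoc]
      by_cases h0 : Q y * W y x = 0
      · simp [h0]
      · refine mul_le_mul_of_nonneg_left ?_
          (mul_nonneg (stdSimplex.zero_le _ _) (stdSimplex.zero_le _ _))
        have hP := pos_of_mem_feasibleSet hfeas h0
        have hW : 0 < W y x := (stdSimplex.zero_le _ _).lt_of_ne' (right_ne_zero_of_mul h0)
        have h1δ : 0 < 1 - δ := by linarith
        rw [← Real.logb_mul (div_pos hW hP).ne' h1δ.ne']
        -- Monotonicity through `V δ ≥ (1 - δ) W`, which costs only `log (1 - δ)`.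
        refine Real.logb_le_logb_of_le one_lt_two (mul_pos (div_pos hW hP) h1δ) ?_
        rw [div_mul_eq_mul_div]
        gcongr
        simp only [hVdef]
        nlinarith [mul_pos hδ hP]
  -- The shift to `k + 1` is needed because `u 0 = 1` violates `δ < 1`.
  have hcont : Tendsto (fun k => channelMutualInfo Q W + Real.logb 2 (1 - u (k + 1))) atTop
      (nhds (channelMutualInfo Q W + Real.logb 2 (1 - 0))) := by
    refine Tendsto.const_add _ ?_
    have h1 : Tendsto (fun k => 1 - u (k + 1)) atTop (nhds (1 - 0)) :=
      ((tendsto_add_atTop_iff_nat 1).2 tendsto_one_div_add_atTop_nhds_zero_nat).const_sub 1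
    exact h1.logb (by norm_num)
  have := le_of_tendsto' hcont fun k => hδ _ (hu0 _) (by
    simp only [hu]
    rw [div_lt_one (by positivity)]
    push_cast
    have : (0 : ℝ) ≤ k := Nat.cast_nonneg k
    linarith)
  simpa using this

end Converse

/-! ### Achievability by random coding. -/

section Achievability

variable {X Y : Type*} [Fintype X] [Fintype Y] {P : stdSimplex ℝ X} {W : Channel Y X}
  {Q : stdSimplex ℝ Y}

/-- The variance of the information density `log (W y x / P x)`. -/
def infoVariance (P : stdSimplex ℝ X) (W : Channel Y X) (Q : stdSimplex ℝ Y) : ℝ :=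
  ∑ z : X × Y, Q z.2 * W z.2 z.1 *
    (Real.logb 2 (W z.2 z.1 / P z.1) - channelMutualInfo Q W) ^ 2

open Classical in
/-- Chebyshev's inequality for the information density of the product channel. -/
theorem sum_atypical_le (hQ : Q ∈ feasibleSet P W) {γ : ℝ} (hγ : 0 < γ) {n : ℕ} (hn : 0 < n) :
    ∑ x, ∑ y, (if (2 : ℝ) ^ (n * (channelMutualInfo Q W + γ)) * iidDist P n x
        < iidChannel W n y x then iidDist Q n y * iidChannel W n y x else 0)
      ≤ infoVariance P W Q / γ ^ 2 / n := by
  have hn' : (0 : ℝ) < n := by exact_mod_cast hn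
  set w : X × Y → ℝ := fun z => Q z.2 * W z.2 z.1 with hw
  set f : X × Y → ℝ := fun z =>
    Real.logb 2 (W z.2 z.1 / P z.1) - channelMutualInfo Q W with hf
  have hw0 : ∀ z, 0 ≤ w z := fun z =>
    mul_nonneg (stdSimplex.zero_le _ _) (stdSimplex.zero_le _ _)
  have hw1 : ∑ z, w z = 1 := by
    simp only [hw]
    rw [Fintype.sum_prod_type_right]
    simp_rw [← Finset.mul_sum, stdSimplex.sum_eq_one, mul_one, stdSimplex.sum_eq_one]
  have hf0 : ∑ z, w z * f z = 0 := by
    simp only [hf, mul_sub, Finset.sum_sub_distrib, ← Finset.sum_mul, hw1, one_mul]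
    rw [channelMutualInfo_eq hQ, Fintype.sum_prod_type_right]
    simp_rw [Finset.mul_sum, ← mul_assoc]
    simp [hw]
  have hvar := sum_pi_weight_mul_sum_sq (ι := Fin n) hw1 f hf0
  rw [Fintype.card_fin] at hvar
  have hpt : ∀ z : Fin n → X × Y,
      (if (2 : ℝ) ^ (n * (channelMutualInfo Q W + γ)) * iidDist P n (fun i => (z i).1)
        < iidChannel W n (fun i => (z i).2) (fun i => (z i).1)
        then iidDist Q n (fun i => (z i).2) * iidChannel W n (fun i => (z i).2) (fun i => (z i).1)
        else 0)
      ≤ (∏ i, w (z i)) * (∑ i, f (z i)) ^ 2 * (1 / (n * γ) ^ 2) := fun z => by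
    have hp0 : 0 ≤ ∏ i, w (z i) := Finset.prod_nonneg fun i _ => hw0 _
    have hprod : iidDist Q n (fun i => (z i).2) *
        iidChannel W n (fun i => (z i).2) (fun i => (z i).1) = ∏ i, w (z i) := by
      simp only [iidDist, iidChannel, hw, Finset.prod_mul_distrib]
    rw [hprod]
    split_ifs with h
    · rcases hp0.eq_or_lt with h0 | h0
      · simp [← h0]
      have hwi : ∀ i, w (z i) ≠ 0 := fun i =>
        Finset.prod_ne_zero_iff.1 h0.ne' i (Finset.mem_univ i)
      have hP : ∀ i, 0 < P (z i).1 := fun i => pos_of_mem_feasibleSet hQ (hwi i)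
      have hW : ∀ i, 0 < W (z i).2 (z i).1 := fun i =>
        (stdSimplex.zero_le _ _).lt_of_ne' (right_ne_zero_of_mul (hwi i))
      have hPn : 0 < iidDist P n fun i => (z i).1 := Finset.prod_pos fun i _ => hP i
      rw [← lt_div_iff₀ hPn] at h
      have h1 := Real.logb_lt_logb one_lt_two (by positivity) h
      rw [Real.logb_rpow two_pos (by norm_num)] at h1
      have h2 : Real.logb 2 (iidChannel W n (fun i => (z i).2) (fun i => (z i).1)
          / iidDist P n fun i => (z i).1) = ∑ i, Real.logb 2 (W (z i).2 (z i).1 / P (z i).1) := by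
        simp only [iidChannel, iidDist]
        rw [← Finset.prod_div_distrib, Real.logb_prod _ _ fun i _ => (div_pos (hW i) (hP i)).ne']
      -- An atypical pair of words has centred information density at least `n * γ`; this is the
      -- deviation in Chebyshev's bound.
      have h3 : n * γ ≤ ∑ i, f (z i) := by
        simp only [hf, Finset.sum_sub_distrib]
        rw [← h2]
        simp only [Finset.sum_const, Finset.card_univ, Fintype.card_fin, nsmul_eq_mul]
        linarith
      have h4 : (n * γ) ^ 2 ≤ (∑ i, f (z i)) ^ 2 := by gcongr
      rw [mul_assoc, mul_one_div]
      exact le_mul_of_one_le_right hp0 ((one_le_div (by positivity)).2 h4)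
    · positivity
  rw [← Fintype.sum_prod_type' (f := fun x y =>
    if (2 : ℝ) ^ (n * (channelMutualInfo Q W + γ)) * iidDist P n x
      < iidChannel W n y x then iidDist Q n y * iidChannel W n y x else 0)]
  -- A pair of words becomes one word over `X × Y`, whose letters are i.i.d. with weight `w`.
  rw [← (Equiv.arrowProdEquivProdArrow (Fin n) (fun _ => X) (fun _ => Y)).sum_comp]
  refine (Finset.sum_le_sum fun z _ => hpt z).trans (le_of_eq ?_)
  rw [← Finset.sum_mul, hvar]
  unfold infoVariance
  field_simp
  rfl

theorem exists_protocol_error_le (hQ : Q ∈ feasibleSet P W) {γ : ℝ} (hγ : 0 < γ)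
    {n Θ : ℕ} (hn : 0 < n) (hΘ : 0 < Θ) :
    ∃ C : Protocol X Y n Θ, C.error P W ≤
      √((2 : ℝ) ^ (n * (channelMutualInfo Q W + γ)) / Θ)
        + 2 * (infoVariance P W Q / γ ^ 2 / n) := by
  classical
  obtain ⟨c, hc⟩ := exists_codebook (iidDist_nonneg Q) (sum_iidDist Q) (iidChannel_nonneg W)
    (sum_iidDist P) (sum_iidDist_mul_iidChannel hQ)
    (L := (2 : ℝ) ^ (n * (channelMutualInfo Q W + γ))) (by positivity) hΘ
  obtain ⟨e, he⟩ := exists_posterior hΘ (k := fun m => iidChannel W n (c m))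
    fun m => iidChannel_nonneg W (c m)
  let D : Fin Θ → stdSimplex ℝ (Fin n → Y) := fun m =>
    ⟨Pi.single (c m) 1, single_mem_stdSimplex ℝ (c m)⟩
  refine ⟨⟨e, D⟩, ?_⟩
  have h := sum_abs_sub_le_of_posterior (iidChannel_nonneg W) (sum_iidChannel W) (iidDist P n)
    c e he D fun m b hb => Pi.single_eq_of_ne hb 1
  -- The factor 2 from the posterior bound cancels the 1/2 of total variation.
  have h' : (⟨e, D⟩ : Protocol X Y n Θ).error P W ≤
      ∑ x, |(1 / (Θ : ℝ)) * ∑ m, iidChannel W n (c m) x - iidDist P n x| := by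
    have : (⟨e, D⟩ : Protocol X Y n Θ).error P W ≤ (1 / 2) * (2 *
        ∑ x, |(1 / (Θ : ℝ)) * ∑ m, iidChannel W n (c m) x - iidDist P n x|) :=
      mul_le_mul_of_nonneg_left h (by norm_num)
    linarith
  refine h'.trans (hc.trans ?_)
  have := sum_atypical_le hQ hγ hn
  gcongr

/-- The slack `ε` is split: the typicality threshold sits at `I + ε/2` and the codebook rate at `I +
ε`, so their ratio decays like `2^(-nε/2)`. -/
theorem isAchievable_of_channelMutualInfo_le (hQ : Q ∈ feasibleSet P W) {R : ℝ}
    (hR : channelMutualInfo Q W ≤ R) : IsAchievable P W R := by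
  intro ε hε
  set I := channelMutualInfo Q W with hI
  have hI0 : 0 ≤ I := channelMutualInfo_nonneg hQ
  have hγ : 0 < ε / 2 := by positivity
  have hr : (2 : ℝ) ^ (-(ε / 2)) < 1 := Real.rpow_lt_one_of_one_lt_of_neg one_lt_two (by linarith)
  have hlim : Tendsto (fun n : ℕ => √(2 * ((2 : ℝ) ^ (-(ε / 2))) ^ n)
      + 2 * (infoVariance P W Q / (ε / 2) ^ 2 / n)) atTop (nhds (√(2 * 0) + 2 * 0)) :=
    ((tendsto_pow_atTop_nhds_zero_of_lt_one (by positivity) hr).const_mul 2).sqrt.add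
      ((tendsto_const_div_atTop_nhds_zero_nat _).const_mul 2)
  rw [mul_zero, Real.sqrt_zero, add_zero] at hlim
  filter_upwards [hlim.eventually_le_const hε, eventually_gt_atTop 0] with n hle hn
  have hn' : (0 : ℝ) < n := by exact_mod_cast hn
  set t : ℝ := (2 : ℝ) ^ (n * (I + ε)) with ht
  have ht1 : 1 ≤ t := Real.one_le_rpow one_le_two (by positivity)
  have hΘ : 0 < ⌊t⌋₊ := Nat.floor_pos.2 ht1
  have hΘ' : (0 : ℝ) < ⌊t⌋₊ := by exact_mod_cast hΘ
  have hfl : (⌊t⌋₊ : ℝ) ≤ t := Nat.floor_le (by linarith)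
  -- Rounding down loses at most a factor 2, the constant under the root in `hlim`.
  have hfl2 : t ≤ 2 * ⌊t⌋₊ := by
    have h1 := Nat.lt_floor_add_one t
    have h2 : (1 : ℝ) ≤ ⌊t⌋₊ := by exact_mod_cast hΘ
    linarith
  obtain ⟨C, hC⟩ := exists_protocol_error_le hQ hγ hn hΘ
  refine ⟨⌊t⌋₊, C, ?_, hC.trans (le_trans ?_ hle)⟩
  · have h1 : Real.logb 2 ⌊t⌋₊ ≤ n * (I + ε) := by
      refine (Real.logb_le_logb_of_le one_lt_two hΘ' hfl).trans (le_of_eq ?_)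
      rw [ht, Real.logb_rpow two_pos (by norm_num)]
    calc (1 / (n : ℝ)) * Real.logb 2 ⌊t⌋₊ ≤ (1 / (n : ℝ)) * (n * (I + ε)) := by gcongr
      _ = I + ε := by field_simp
      _ ≤ R + ε := by linarith
  · gcongr
    rw [div_le_iff₀ hΘ']
    have h1 : (2 : ℝ) ^ (n * (I + ε / 2)) = ((2 : ℝ) ^ (-(ε / 2))) ^ n * t := by
      rw [← Real.rpow_natCast, ← Real.rpow_mul two_pos.le, ht, ← Real.rpow_add two_pos]
      congr 1; ring
    rw [h1]
    nlinarith [pow_pos (Real.rpow_pos_of_pos two_pos (-(ε / 2))) n]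

end Achievability

end LossySourceCoding

end

theorem theorem3 {X Xhat : Type*} [Fintype X] [Fintype Xhat]
    (P : stdSimplex ℝ X) (W : LossySourceCoding.Channel Xhat X) (R : ℝ) :
    ((LossySourceCoding.feasibleSet P W).Nonempty →
      ∃ Q ∈ LossySourceCoding.feasibleSet P W,
        IsMinOn (fun Q => LossySourceCoding.channelMutualInfo Q W)
          (LossySourceCoding.feasibleSet P W) Q) ∧
    (LossySourceCoding.IsAchievable P W R ↔
      (LossySourceCoding.feasibleSet P W).Nonempty ∧
      ∃ I : ℝ, IsLeast ((fun Q => LossySourceCoding.channelMutualInfo Q W) ''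
          LossySourceCoding.feasibleSet P W) I ∧ I ≤ R) := by
  refine ⟨LossySourceCoding.exists_isMinOn_channelMutualInfo, fun hR => ?_, ?_⟩
  · obtain ⟨Q, hQ, hle⟩ := hR.exists_feasible
    obtain ⟨Q₀, hQ₀, hmin⟩ := LossySourceCoding.exists_isMinOn_channelMutualInfo ⟨Q, hQ⟩
    refine ⟨⟨Q, hQ⟩, _, ⟨⟨Q₀, hQ₀, rfl⟩, ?_⟩, (hmin hQ).trans hle⟩
    rintro _ ⟨Q', hQ', rfl⟩
    exact hmin hQ'
  · rintro ⟨-, I, ⟨⟨Q, hQ, rfl⟩, -⟩, hle⟩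
    exact LossySourceCoding.isAchievable_of_channelMutualInfo_le hQ hle
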